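/- Let $\mathbb{T}^\infty$ be the infinite-dimensional torus with its normalized Haar measure (the product of the normalized Lebesgue measures of the countably many circles), with coordinates $z=(z_1,z_2,\ldots)$. Let $H^2(\mathbb{T}^\infty)$ be the closure in $L^2(\mathbb{T}^\infty)$ of the analytic polynomials, i.e. of the polynomials in finitely many of the variables $z_1,z_2,\ldots$, and let $P_+$ be the orthogonal projection of $L^2(\mathbb{T}^\infty)$ onto $H^2(\mathbb{T}^\infty)$. For $n\ge 1$ with prime factorization $n=\prod_j p_j^{\kappa_j}$, where $p_1<p_2<\cdots$ are the primes, put $z^{\kappa(n)}=\prod_j z_j^{\kappa_j}$. For a Dirichlet series $\varphi(s)=\sum_{n\ge1}\alpha(n)n^{-s}$ in $\mathcal{H}^2$, that is, with complex coefficients satisfying $\sum_{n\ge 1}|\alpha(n)|^2<\infty$, its Bohr lift is $\mathcal{B}\varphi(z)=\sum_{n\ge1}\alpha(n)z^{\kappa(n)}$, with convergence in $L^2(\mathbb{T}^\infty)$. For $\Phi\in L^2(\mathbb{T}^\infty)$, the Hankel form $H_\Phi$ is given on analytic polynomials $F,G$ by $$H_\Phi(F,G)=\langle FG,\Phi\rangle_{L^2(\mathbb{T}^\infty)}=\int_{\mathbb{T}^\infty}FG\,\overline{\Phi},$$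 and it is called bounded on $H^2(\mathbb{T}^\infty)\times H^2(\mathbb{T}^\infty)$ if it extends to a bounded bilinear form there. Theorem. Suppose that $\varphi(s)=\sum_{n\ge1}\alpha(n)n^{-s}$ is in $\mathcal{H}^2$ and that $\alpha$ is multiplicative, i.e. $\alpha(1)=1$ and $\alpha(mn)=\alpha(m)\alpha(n)$ whenever $\gcd(m,n)=1$. If $H_{\mathcal{B}\varphi}$ is bounded on $H^2(\mathbb{T}^\infty)\times H^2(\mathbb{T}^\infty)$, then there exists $\Psi\in L^\infty(\mathbb{T}^\infty)$ such that $\mathcal{B}\varphi=P_+\Psi$. Moreover, if $\alpha$ is completely multiplicative, i.e. $\alpha(mn)=\alpha(m)\alpha(n)$ for all $m,n\ge1$, then $H_{\mathcal{B}\varphi}$ is always bounded on $H^2(\mathbb{T}^\infty)\times H^2(\mathbb{T}^\infty)$. -/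

import Mathlib

open MeasureTheory
open scoped ENNReal

noncomputable section

/-- The normalized Haar measure on the infinite torus `𝕋^∞ = (ℝ/ℤ)^ℕ`: the product of the
normalized Lebesgue measures of the factors. -/
def torusMeasure : Measure (UnitAddTorus ℕ) :=
  Measure.infinitePi fun _ : ℕ => (AddCircle.haarAddCircle : Measure UnitAddCircle)

instance : IsProbabilityMeasure torusMeasure := by
  unfold torusMeasure; infer_instance

/-- The Hilbert space `L²(𝕋^∞)`. -/
abbrev TorusL2 : Type := Lp ℂ 2 torusMeasure

/-- The coordinate `z_j` on `𝕋^∞`: the point `θ` has `z_j = exp (2πi θ_j)`. -/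
def torusCoord (j : ℕ) : C(UnitAddTorus ℕ, ℂ) where
  toFun θ := (AddCircle.toCircle (θ j) : ℂ)
  continuous_toFun :=
    continuous_subtype_val.comp (AddCircle.continuous_toCircle.comp (continuous_apply j))

/-- Analytic polynomials in the variables `z_0, z_1, …`, as continuous functions on `𝕋^∞`. -/
def torusPoly : MvPolynomial ℕ ℂ →ₐ[ℂ] C(UnitAddTorus ℕ, ℂ) :=
  MvPolynomial.aeval torusCoord

/-- Analytic polynomials as elements of `L²(𝕋^∞)`. -/
def torusPolyL2 : MvPolynomial ℕ ℂ →ₗ[ℂ] TorusL2 :=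
  (ContinuousMap.toLp 2 torusMeasure ℂ).toLinearMap ∘ₗ torusPoly.toLinearMap

/-- The Hardy space `H²(𝕋^∞)`: the closure of the analytic polynomials in `L²(𝕋^∞)`. -/
def hardyH2 : Submodule ℂ TorusL2 :=
  (LinearMap.range torusPolyL2).topologicalClosure

instance : CompleteSpace hardyH2 :=
  (Submodule.isClosed_topologicalClosure _).completeSpace_coe

/-- An analytic polynomial as an element of `H²(𝕋^∞)`. -/
def hardyPoly (P : MvPolynomial ℕ ℂ) : hardyH2 :=
  ⟨torusPolyL2 P, Submodule.le_topologicalClosure _ (LinearMap.mem_range_self _ P)⟩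

/-- The Riesz projection `P_+`: the orthogonal projection of `L²(𝕋^∞)` onto `H²(𝕋^∞)`. -/
def rieszProj : TorusL2 →L[ℂ] TorusL2 := hardyH2.starProjection

/-- The Hankel form `H_Φ(F, G) = ⟨F G, Φ⟩ = ∫ F G conj(Φ)` on polynomials `F`, `G`
(Mathlib's inner product is conjugate-linear in its first argument). -/
def hankelForm (Φ : TorusL2) (F G : MvPolynomial ℕ ℂ) : ℂ :=
  inner ℂ Φ (torusPolyL2 (F * G))

/-- `H_Φ` is bounded on `H²(𝕋^∞) × H²(𝕋^∞)`: it extends from polynomials to a bounded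
bilinear form. -/
def IsBoundedHankelForm (Φ : TorusL2) : Prop :=
  ∃ B : hardyH2 →L[ℂ] hardyH2 →L[ℂ] ℂ,
    ∀ F G : MvPolynomial ℕ ℂ, B (hardyPoly F) (hardyPoly G) = hankelForm Φ F G

/-- The multi-index `κ(n)` of the prime factorization `n = ∏ p_j ^ κ_j`, where
`p_0 = 2, p_1 = 3, …` are the primes in increasing order. -/
def primeExponents (n : ℕ) : ℕ →₀ ℕ :=
  n.factorization.comapDomain (Nat.nth Nat.Prime)
    (Nat.nth_injective Nat.infinite_setOfPred_prime).injOn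

/-- The Dirichlet series `∑ α(n) n^{-s}` is in `ℋ²`: its coefficients are square summable. -/
def MemDirichletH2 (α : ArithmeticFunction ℂ) : Prop :=
  Summable fun n : ℕ => ‖α n‖ ^ 2

/-- The Bohr lift `∑ α(n) z^{κ(n)}` of the Dirichlet series `∑ α(n) n^{-s}` in `ℋ²`, with the
series summed in `L²(𝕋^∞)` (recall `α 0 = 0`, so that the sum is over `n ≥ 1`). -/
def bohrLift (α : ArithmeticFunction ℂ) : TorusL2 :=
  ∑' n : ℕ, α n • torusPolyL2 (MvPolynomial.monomial (primeExponents n) 1)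


theorem torusPoly_monomial (k : ℕ →₀ ℕ) (θ : UnitAddTorus ℕ) :
    torusPoly (MvPolynomial.monomial k 1) θ = k.prod fun j e => fourier e (θ j) := by
  simp only [torusPoly, MvPolynomial.aeval_monomial, map_one, one_mul, Finsupp.prod,
    ContinuousMap.prod_apply, ContinuousMap.pow_apply, torusCoord, ContinuousMap.coe_mk,
    fourier_apply]
  refine Finset.prod_congr rfl fun j _ => ?_
  simp [AddCircle.toCircle_nsmul]

theorem integral_fourier_haar (n : ℤ) :
    ∫ x : UnitAddCircle, fourier n x ∂AddCircle.haarAddCircle = if n = 0 then 1 else 0 := by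
  have h := orthonormal_iff_ite.mp (orthonormal_fourier (T := 1)) 0 n
  have h2 := ContinuousMap.inner_toLp (𝕜 := ℂ) (@AddCircle.haarAddCircle 1 _)
    (fourier 0) (fourier n)
  simp only [fourierLp] at h
  rw [h2] at h
  simp only [fourier_zero, map_one, mul_one] at h
  rw [h]; simp [eq_comm]

theorem orthonormal_monomials :
    Orthonormal ℂ fun k : ℕ →₀ ℕ => torusPolyL2 (MvPolynomial.monomial k 1) := by
  rw [orthonormal_iff_ite]
  intro k l
  have h := ContinuousMap.inner_toLp (𝕜 := ℂ) torusMeasure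
    (torusPoly (MvPolynomial.monomial k 1)) (torusPoly (MvPolynomial.monomial l 1))
  change inner ℂ (ContinuousMap.toLp 2 torusMeasure ℂ _)
    (ContinuousMap.toLp 2 torusMeasure ℂ _) = _
  erw [h]
  classical
  set s := k.support ∪ l.support
  have key : ∀ θ : UnitAddTorus ℕ, torusPoly (MvPolynomial.monomial l 1) θ *
      (starRingEnd ℂ) (torusPoly (MvPolynomial.monomial k 1) θ) =
      (fun y : s → UnitAddCircle => ∏ i : s, fourier ((l i : ℤ) - k i) (y i)) (s.restrict θ) := by
    intro θ
    rw [torusPoly_monomial, torusPoly_monomial,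
      Finsupp.prod_of_support_subset l (s := s) Finset.subset_union_right _ (by simp),
      Finsupp.prod_of_support_subset k (s := s) Finset.subset_union_left _ (by simp),
      map_prod, ← Finset.prod_mul_distrib]
    simp only [Finset.restrict]
    rw [Finset.prod_coe_sort s (fun i => fourier ((l i : ℤ) - k i) (θ i))]
    refine Finset.prod_congr rfl fun j _ => ?_
    rw [sub_eq_add_neg, fourier_add, fourier_neg]
  rw [integral_congr_ae (Filter.Eventually.of_forall key), torusMeasure]
  refine (integral_restrict_infinitePi (s := s)
    (μ := fun _ : ℕ => (AddCircle.haarAddCircle : Measure UnitAddCircle))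
    (f := fun y : s → UnitAddCircle => ∏ i : s, fourier ((l i : ℤ) - k i) (y i)) ?_).trans ?_
  rotate_left
  · rw [integral_fintype_prod_eq_prod]
    simp only [integral_fourier_haar]
    split_ifs with hkl
    · subst hkl; simp
    · obtain ⟨j, hj⟩ := Finsupp.ne_iff.mp hkl
      have hjs : j ∈ s := by
        simp only [s, Finset.mem_union, Finsupp.mem_support_iff]; omega
      exact Finset.prod_eq_zero (Finset.mem_univ (⟨j, hjs⟩ : s)) (if_neg (by simp; omega))
  · exact Continuous.aestronglyMeasurable (by fun_prop)

theorem primeExponents_injOn : Set.InjOn primeExponents {n | n ≠ 0} := by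
  intro m hm n hn h
  refine Nat.eq_of_factorization_eq hm hn fun p => ?_
  by_cases hp : p.Prime
  · obtain ⟨j, rfl⟩ : ∃ j, Nat.nth Nat.Prime j = p := by
      exact ⟨Nat.count Nat.Prime p, Nat.nth_count hp⟩
    exact DFunLike.congr_fun h j
  · simp [Nat.factorization_eq_zero_of_not_prime, hp]

/-- The series defining the Bohr lift converges in `L²(𝕋^∞)`. -/
theorem hasSum_bohrLift {α : ArithmeticFunction ℂ} (hα : MemDirichletH2 α) :
    HasSum (fun n : ℕ => α n • torusPolyL2 (MvPolynomial.monomial (primeExponents n) 1))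
      (bohrLift α) := by
  refine Summable.hasSum ?_
  have hinj : Function.Injective fun n : {n : ℕ // n ≠ 0} => primeExponents n :=
    fun m n h => Subtype.ext (primeExponents_injOn m.2 n.2 h)
  have ho := (orthonormal_monomials.comp _ hinj).orthogonalFamily
  have hs := (ho.summable_iff_norm_sq_summable fun n => α n).mpr
    (hα.comp_injective Subtype.val_injective)
  refine (Function.Injective.summable_iff (g := ((↑) : {n : ℕ // n ≠ 0} → ℕ))
    Subtype.val_injective ?_).mp hs
  intro n hn
  have : n = 0 := by simpa using hn
  simp [this]

end

/-! Write l(P) = ⟨P, ℬφ⟩ on analytic polynomials, with |l(FG)| ≤ C‖F‖₂‖G‖₂. By Hahn-Banach and Riesz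
(`exists_bounded_symbol`), a bounded Ψ with P₊Ψ = ℬφ exists as soon as |l(P)| ≤ C‖P‖₁ for every P,
so the task is this L¹ bound (`norm_le_integral_torus`).

Multiplicativity of α makes l split over variables: l(∏ F_j(z_j)) = ∏ l(F_j(z_j)). Let c_j be the
Hankel norm of l restricted to polynomials in z_j. Testing the form on products of nearly extremal
one-variable polynomials shows that every finite product of the c_j is at most C
(`prod_hankelNorm_le`). The one-variable theorem `nehari` gives a symbol ψ_j with |ψ_j| ≤ c_j, and
on polynomials in the variables of a finite set s, l is integration against ∏_{j∈s} conj ψ_j, of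
modulus at most C. The constant does not depend on s, so no infinite product has to converge. The
sharp constant in `nehari` is essential, since a loss in each variable would accumulate.

Nehari's theorem follows from the same duality once each polynomial P on the circle is written as FG
with F, G in the disk algebra and |F| = |G| there (`hasBalancedFactorization_circlePoly`): then
‖F‖₂‖G‖₂ = ‖P‖₁.

If α is completely multiplicative, l is a character, so the Hankel form is l(F)l(G), a rank one
form, bounded because ℬφ is in L². -/

noncomputable section

/-! ### Duality: from L¹ bounds to bounded symbols -/

/-- **Hahn-Banach** for a functional dominated by a seminorm pulled back along a linear map. -/
theorem exists_dual_comp_eq_of_le_seminorm {V E : Type*} [AddCommGroup V] [Module ℂ V]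
    [AddCommGroup E] [Module ℂ E] (T : V →ₗ[ℂ] E) (l : V →ₗ[ℂ] ℂ) (p : Seminorm ℂ E)
    (h : ∀ v, ‖l v‖ ≤ p (T v)) :
    ∃ g : E →ₗ[ℂ] ℂ, (∀ v, g (T v) = l v) ∧ ∀ x, ‖g x‖ ≤ p x := by
  -- The bound makes l vanish on ker T, so l factors through T and Hahn-Banach applies on the range.
  have hker : l ∈ LinearMap.range T.dualMap := by
    rw [LinearMap.range_dualMap_eq_dualAnnihilator_ker, Submodule.mem_dualAnnihilator]
    intro v hv
    have := h v
    rw [LinearMap.mem_ker.mp hv, map_zero] at this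
    exact norm_le_zero_iff.mp this
  obtain ⟨l', rfl⟩ := hker
  obtain ⟨g, hg, hgp⟩ := Module.Dual.exists_extension_of_le_seminorm (p := p)
    (LinearMap.range T) (l'.domRestrict (LinearMap.range T)) (by
      rintro ⟨_, v, rfl⟩
      exact h v)
  exact ⟨g, fun v => hg ⟨T v, v, rfl⟩, hgp⟩

section BoundedSymbol

variable {X : Type*} [MeasurableSpace X] {μ : Measure X} [IsProbabilityMeasure μ]

theorem integrable_of_Lp_two (f : Lp ℂ 2 μ) : Integrable f μ :=
  (Lp.memLp f).integrable (by norm_num)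

theorem integral_norm_le_norm_Lp_two (f : Lp ℂ 2 μ) : ∫ x, ‖f x‖ ∂μ ≤ ‖f‖ := by
  have h := eLpNorm_le_eLpNorm_of_exponent_le (p := 1) (q := 2) (μ := μ) (by norm_num)
    (Lp.aestronglyMeasurable f)
  rw [integral_norm_eq_lintegral_enorm (Lp.aestronglyMeasurable f), ← eLpNorm_one_eq_lintegral_enorm,
    Lp.norm_def]
  exact ENNReal.toReal_mono (Lp.eLpNorm_ne_top f) h

/-- The multiple by `c` of the `L¹` norm, as a seminorm on `L²` of a probability space. -/
def l1Seminorm (μ : Measure X) [IsProbabilityMeasure μ] (c : ℝ) (hc : 0 ≤ c) :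
    Seminorm ℂ (Lp ℂ 2 μ) :=
  Seminorm.of (fun f => c * ∫ x, ‖f x‖ ∂μ)
    (fun f g => by
      rw [← mul_add, ← integral_add (integrable_of_Lp_two f).norm (integrable_of_Lp_two g).norm]
      refine mul_le_mul_of_nonneg_left (integral_mono_ae (integrable_of_Lp_two _).norm
        ((integrable_of_Lp_two f).norm.add (integrable_of_Lp_two g).norm) ?_) hc
      filter_upwards [Lp.coeFn_add f g] with x hx
      rw [hx]
      exact norm_add_le _ _)
    (fun a f => by
      have : ∫ x, ‖(a • f : Lp ℂ 2 μ) x‖ ∂μ = ‖a‖ * ∫ x, ‖f x‖ ∂μ := by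
        rw [← integral_const_mul]
        refine integral_congr_ae ?_
        filter_upwards [Lp.coeFn_smul a f] with x hx
        rw [hx, Pi.smul_apply, norm_smul]
      rw [this]; ring)

/-- An element of `L²` whose pairings are dominated by `c` times the `L¹` norm is bounded
by `c`. -/
theorem ae_norm_le_of_norm_inner_le (c : ℝ) (ψ : Lp ℂ 2 μ)
    (h : ∀ f : Lp ℂ 2 μ, ‖inner ℂ ψ f‖ ≤ c * ∫ x, ‖f x‖ ∂μ) : ∀ᵐ x ∂μ, ‖ψ x‖ ≤ c := by
  set ψ' := (Lp.aestronglyMeasurable ψ).mk ψ with hψ'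
  have hm : StronglyMeasurable ψ' := (Lp.aestronglyMeasurable ψ).stronglyMeasurable_mk
  have hae : ψ =ᵐ[μ] ψ' := (Lp.aestronglyMeasurable ψ).ae_eq_mk
  -- Testing against ψ·1_S gives ∫_S |ψ|² ≤ c ∫_S |ψ|, although |ψ|² > c|ψ| at points of S where ψ ≠
  -- 0; hence S is null.
  set S : Set X := {x | c < ‖ψ' x‖} with hS
  have hSm : MeasurableSet S := measurableSet_lt measurable_const hm.norm.measurable
  have hψ'L : MemLp ψ' 2 μ := (memLp_congr_ae hae).mp (Lp.memLp ψ)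
  have hf : MemLp (S.indicator ψ') 2 μ := hψ'L.indicator hSm
  have hInt : Integrable (S.indicator ψ') μ := hf.integrable (by norm_num)
  have key := h (hf.toLp _)
  have h1 : ∫ x, ‖(hf.toLp _ : Lp ℂ 2 μ) x‖ ∂μ = ∫ x, ‖S.indicator ψ' x‖ ∂μ := by
    refine integral_congr_ae ?_
    filter_upwards [hf.coeFn_toLp] with x hx
    rw [hx]
  have h2 : inner ℂ ψ (hf.toLp _) = ((∫ x, ‖S.indicator ψ' x‖ ^ 2 ∂μ : ℝ) : ℂ) := by
    rw [L2.inner_def, ← integral_complex_ofReal]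
    refine integral_congr_ae ?_
    filter_upwards [hf.coeFn_toLp, hae] with x hx hx'
    rw [hx, hx']
    by_cases hxS : x ∈ S
    · simp [Set.indicator_of_mem hxS]
    · simp [Set.indicator_of_notMem hxS]
  rw [h1, h2, Complex.norm_real, Real.norm_of_nonneg (by positivity), ← integral_const_mul] at key
  have hsq : Integrable (fun x => ‖S.indicator ψ' x‖ ^ 2) μ := hf.integrable_norm_pow (by norm_num)
  have hnn : 0 ≤ fun x => ‖S.indicator ψ' x‖ ^ 2 - c * ‖S.indicator ψ' x‖ := by
    intro x
    by_cases hxS : x ∈ S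
    · have : c < ‖ψ' x‖ := hxS
      simp only [Set.indicator_of_mem hxS, Pi.zero_apply]
      nlinarith [norm_nonneg (ψ' x)]
    · simp [Set.indicator_of_notMem hxS]
  have hz : ∫ x, (‖S.indicator ψ' x‖ ^ 2 - c * ‖S.indicator ψ' x‖) ∂μ = 0 := by
    refine le_antisymm ?_ (integral_nonneg hnn)
    rw [integral_sub hsq (hInt.norm.const_mul c)]
    linarith
  rw [integral_eq_zero_iff_of_nonneg hnn (hsq.sub (hInt.norm.const_mul c))] at hz
  -- Tested on the constant 1; needed so that ψ' is nonzero on S.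
  have hc : 0 ≤ c := by
    have := h ((memLp_const (1 : ℂ)).toLp _)
    have h3 : ∫ x, ‖(((memLp_const (1 : ℂ)).toLp _ : Lp ℂ 2 μ)) x‖ ∂μ = 1 := by
      rw [integral_congr_ae (g := fun _ => (1 : ℝ)), integral_const]
      · simp
      · filter_upwards [(memLp_const (μ := μ) (p := 2) (1 : ℂ)).coeFn_toLp] with x hx
        rw [hx]; simp
    rw [h3, mul_one] at this
    exact (norm_nonneg _).trans this
  filter_upwards [hz, hae] with x hx hx'
  rw [hx']
  by_contra hcon
  have hxS : x ∈ S := not_le.mp hcon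
  have : c < ‖ψ' x‖ := hxS
  simp only [Set.indicator_of_mem hxS, Pi.zero_apply] at hx
  nlinarith [norm_nonneg (ψ' x)]

/-- A functional dominated by `c` times the `L¹` norm is integration against a function bounded
by `c`. -/
theorem exists_bounded_symbol {V : Type*} [AddCommGroup V] [Module ℂ V]
    (T : V →ₗ[ℂ] Lp ℂ 2 μ) (l : V →ₗ[ℂ] ℂ) (c : ℝ) (hc : 0 ≤ c)
    (h : ∀ v, ‖l v‖ ≤ c * ∫ x, ‖T v x‖ ∂μ) :
    ∃ ψ : X → ℂ, StronglyMeasurable ψ ∧ (∀ x, ‖ψ x‖ ≤ c) ∧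
      ∀ v, l v = ∫ x, T v x * (starRingEnd ℂ) (ψ x) ∂μ := by
  obtain ⟨g, hg, hgp⟩ := exists_dual_comp_eq_of_le_seminorm T l (l1Seminorm μ c hc) h
  let G : StrongDual ℂ (Lp ℂ 2 μ) := g.mkContinuous c fun f =>
    (hgp f).trans (mul_le_mul_of_nonneg_left (integral_norm_le_norm_Lp_two f) hc)
  let ψ : Lp ℂ 2 μ := (InnerProductSpace.toDual ℂ _).symm G
  have hψ : ∀ f, inner ℂ ψ f = g f := fun f => InnerProductSpace.toDual_symm_apply
  have hb : ∀ᵐ x ∂μ, ‖ψ x‖ ≤ c :=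
    ae_norm_le_of_norm_inner_le c ψ fun f => by rw [hψ]; exact hgp f
  set ψ' := (Lp.aestronglyMeasurable ψ).mk ψ with hψ'
  have hm : StronglyMeasurable ψ' := (Lp.aestronglyMeasurable ψ).stronglyMeasurable_mk
  have hae : ψ =ᵐ[μ] ψ' := (Lp.aestronglyMeasurable ψ).ae_eq_mk
  have hSm : MeasurableSet {x | ‖ψ' x‖ ≤ c} := measurableSet_le hm.norm.measurable measurable_const
  -- Truncation makes the bound hold at every point, so symbols in different variables can later be
  -- multiplied pointwise.
  refine ⟨{x | ‖ψ' x‖ ≤ c}.indicator ψ', hm.indicator hSm, fun x => ?_, fun v => ?_⟩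
  · by_cases hx : x ∈ {x | ‖ψ' x‖ ≤ c}
    · rw [Set.indicator_of_mem hx]; exact hx
    · rw [Set.indicator_of_notMem hx, norm_zero]; exact hc
  · rw [← hg, ← hψ, L2.inner_def]
    refine integral_congr_ae ?_
    filter_upwards [hae, hb] with x hx hbx
    have : x ∈ {x | ‖ψ' x‖ ≤ c} := by rw [hx] at hbx; exact hbx
    rw [Set.indicator_of_mem this, ← hx, RCLike.inner_apply]

end BoundedSymbol

/-! ### Disk algebra and balanced factorization of polynomials -/

/-- The polynomial `∑ c_k z ^ k` as a continuous function on the circle. -/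
def circlePoly : Polynomial ℂ →ₐ[ℂ] C(UnitAddCircle, ℂ) :=
  Polynomial.aeval (fourier 1)

theorem norm_fourier_one (θ : UnitAddCircle) : ‖fourier 1 θ‖ = 1 := by
  rw [fourier_apply]
  exact Circle.norm_coe _

theorem circlePoly_apply (P : Polynomial ℂ) (θ : UnitAddCircle) :
    circlePoly P θ = P.eval (fourier 1 θ) := by
  have := Polynomial.aeval_algHom_apply (ContinuousMap.evalAlgHom ℂ ℂ θ)
    (fourier 1 : C(UnitAddCircle, ℂ)) P
  rw [Polynomial.coe_aeval_eq_eval] at this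
  exact this.symm

/-- The disk algebra: uniform limits of analytic polynomials on the circle. -/
def diskAlgebra : Subalgebra ℂ C(UnitAddCircle, ℂ) :=
  circlePoly.range.topologicalClosure

theorem isClosed_diskAlgebra : IsClosed (diskAlgebra : Set C(UnitAddCircle, ℂ)) :=
  Subalgebra.isClosed_topologicalClosure _

theorem circlePoly_mem_diskAlgebra (P : Polynomial ℂ) : circlePoly P ∈ diskAlgebra :=
  Subalgebra.le_topologicalClosure _ ⟨P, rfl⟩

/-- The Taylor polynomials of h at 0 converge uniformly on a ball of radius r with |b| < r < R,
which contains the circle of all bz. -/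
theorem mem_diskAlgebra_of_differentiableOn {h : ℂ → ℂ} {R : NNReal}
    (hd : DifferentiableOn ℂ h (Metric.closedBall 0 R)) {b : ℂ} (hb : ‖b‖ < R)
    (F : C(UnitAddCircle, ℂ)) (hF : ∀ θ, F θ = h (b * fourier 1 θ)) : F ∈ diskAlgebra := by
  have hR : 0 < R := by exact_mod_cast (norm_nonneg b).trans_lt hb
  have hp := hd.hasFPowerSeriesOnBall hR
  set p := cauchyPowerSeries h 0 R
  obtain ⟨r, hbr, hrR⟩ := exists_between (show ‖b‖₊ < R from hb)
  have hu := hp.tendstoUniformlyOn (r' := r) (by exact_mod_cast hrR)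
  refine isClosed_diskAlgebra.mem_of_tendsto (b := Filter.atTop)
    (f := fun n => circlePoly (∑ k ∈ Finset.range n, Polynomial.C (p.coeff k * b ^ k) *
      Polynomial.X ^ k)) ?_ (Filter.Eventually.of_forall fun n => circlePoly_mem_diskAlgebra _)
  rw [ContinuousMap.tendsto_iff_tendstoUniformly, Metric.tendstoUniformly_iff]
  rw [Metric.tendstoUniformlyOn_iff] at hu
  intro ε hε
  filter_upwards [hu ε hε] with n hn θ
  have := hn (b * fourier 1 θ) (by
    rw [mem_ball_zero_iff, norm_mul, norm_fourier_one, mul_one]; exact hbr)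
  rw [zero_add] at this
  rw [hF, circlePoly_apply]
  convert this using 2
  simp only [FormalMultilinearSeries.partialSum, Polynomial.eval_finsetSum, Polynomial.eval_mul,
    Polynomial.eval_C, Polynomial.eval_pow, Polynomial.eval_X]
  refine Finset.sum_congr rfl fun k _ => ?_
  rw [FormalMultilinearSeries.apply_eq_pow_smul_coeff, smul_eq_mul, mul_pow]
  ring

theorem re_one_sub_nonneg {w : ℂ} (hw : ‖w‖ ≤ 1) : 0 ≤ (1 - w).re := by
  have := (Complex.re_le_norm w).trans hw
  simpa using this

/-- The function `(1 - b z) ^ (1 / 2)` on the circle, jointly continuous in `|b| ≤ 1` and `z`. -/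
def sqrtOneSub : C(Metric.closedBall (0 : ℂ) 1, C(UnitAddCircle, ℂ)) :=
  ContinuousMap.curry
    { toFun := fun p => (1 - (p.1 : ℂ) * fourier 1 p.2) ^ (1 / 2 : ℂ)
      continuous_toFun := by
        rw [continuous_iff_continuousAt]
        intro p
        have h1 : ContinuousAt (fun x : ℂ => x ^ (1 / 2 : ℂ)) (1 - (p.1 : ℂ) * fourier 1 p.2) := by
          -- The principal square root is continuous on the closed right half-plane, including 0,
          -- which 1 - bz attains when |b| = 1.
          refine Complex.continuousAt_cpow_const_of_re_pos (Or.inl (re_one_sub_nonneg ?_))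
            (by norm_num)
          rw [norm_mul, norm_fourier_one, mul_one]
          exact mem_closedBall_zero_iff.mp p.1.2
        exact ContinuousAt.comp (f := fun p : Metric.closedBall (0 : ℂ) 1 × UnitAddCircle =>
          1 - (p.1 : ℂ) * fourier 1 p.2) h1 (by fun_prop) }

theorem sqrtOneSub_apply (b : Metric.closedBall (0 : ℂ) 1) (θ : UnitAddCircle) :
    sqrtOneSub b θ = (1 - (b : ℂ) * fourier 1 θ) ^ (1 / 2 : ℂ) := rfl

theorem sqrtOneSub_mul_self (b : Metric.closedBall (0 : ℂ) 1) (θ : UnitAddCircle) :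
    sqrtOneSub b θ * sqrtOneSub b θ = 1 - (b : ℂ) * fourier 1 θ := by
  rw [sqrtOneSub_apply, ← sq]
  simp

theorem one_sub_mem_slitPlane {R : NNReal} (hR : R < 1) {w : ℂ}
    (hw : w ∈ Metric.closedBall (0 : ℂ) R) : 1 - w ∈ Complex.slitPlane := by
  have h1 : ‖w‖ < 1 := (mem_closedBall_zero_iff.mp hw).trans_lt (by exact_mod_cast hR)
  rw [sub_eq_add_neg]
  exact Complex.mem_slitPlane_of_norm_lt_one (by rwa [norm_neg])

theorem sqrtOneSub_mem_of_norm_lt_one (b : Metric.closedBall (0 : ℂ) 1) (hb : ‖(b : ℂ)‖ < 1) :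
    sqrtOneSub b ∈ diskAlgebra := by
  obtain ⟨R, hbR, hR⟩ := exists_between (show ‖(b : ℂ)‖₊ < 1 from hb)
  refine mem_diskAlgebra_of_differentiableOn (h := fun w => (1 - w) ^ (1 / 2 : ℂ)) (R := R)
    ?_ hbR _ fun θ => rfl
  intro w hw
  exact ((differentiableAt_id.const_sub 1).cpow_const
    (one_sub_mem_slitPlane hR hw)).differentiableWithinAt

/-- When |b| = 1 the root is not holomorphic across the circle. Shrinking b by n/(n+1) gives
elements of the disk algebra that converge uniformly, by joint continuity, and the algebra is
closed. -/
theorem sqrtOneSub_mem_diskAlgebra (b : Metric.closedBall (0 : ℂ) 1) :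
    sqrtOneSub b ∈ diskAlgebra := by
  have hb : ‖(b : ℂ)‖ ≤ 1 := mem_closedBall_zero_iff.mp b.2
  have ht (n : ℕ) : ‖(((n : ℝ) / (n + 1) : ℝ) : ℂ) * b‖ < 1 := by
    rw [norm_mul, Complex.norm_real, Real.norm_of_nonneg (by positivity)]
    have : (n : ℝ) / (n + 1) < 1 := by rw [div_lt_one (by positivity)]; linarith
    exact (mul_le_of_le_one_right (by positivity) hb).trans_lt this
  let u : ℕ → Metric.closedBall (0 : ℂ) 1 := fun n =>
    ⟨(((n : ℝ) / (n + 1) : ℝ) : ℂ) * b, mem_closedBall_zero_iff.mpr (ht n).le⟩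
  have hu : Filter.Tendsto u Filter.atTop (nhds b) := by
    rw [tendsto_subtype_rng]
    have h1 : Filter.Tendsto (fun n : ℕ => (((n : ℝ) / (n + 1) : ℝ) : ℂ)) Filter.atTop
        (nhds ((1 : ℝ) : ℂ)) :=
      (Complex.continuous_ofReal.tendsto 1).comp (tendsto_natCast_div_add_atTop (1 : ℝ))
    have h2 := h1.mul_const (b : ℂ)
    rw [Complex.ofReal_one, one_mul] at h2
    exact h2
  exact isClosed_diskAlgebra.mem_of_tendsto ((sqrtOneSub.continuous.tendsto b).comp hu)
    (Filter.Eventually.of_forall fun n => sqrtOneSub_mem_of_norm_lt_one _ (ht n))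

/-- `f` is a product of two functions of the disk algebra of equal moduli on the circle. -/
def HasBalancedFactorization (f : C(UnitAddCircle, ℂ)) : Prop :=
  ∃ F ∈ diskAlgebra, ∃ G ∈ diskAlgebra, F * G = f ∧ ∀ θ, ‖F θ‖ = ‖G θ‖

theorem HasBalancedFactorization.mul {f g : C(UnitAddCircle, ℂ)}
    (hf : HasBalancedFactorization f) (hg : HasBalancedFactorization g) :
    HasBalancedFactorization (f * g) := by
  obtain ⟨F, hF, G, hG, rfl, h⟩ := hf
  obtain ⟨F', hF', G', hG', rfl, h'⟩ := hg
  refine ⟨F * F', mul_mem hF hF', G * G', mul_mem hG hG', by ring, fun θ => ?_⟩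
  simp [h, h']

theorem hasBalancedFactorization_C (a : ℂ) :
    HasBalancedFactorization (circlePoly (Polynomial.C a)) := by
  obtain ⟨w, rfl⟩ := IsAlgClosed.exists_eq_mul_self a
  exact ⟨_, circlePoly_mem_diskAlgebra (.C w), _, circlePoly_mem_diskAlgebra (.C w),
    by rw [← map_mul, ← map_mul], fun θ => rfl⟩

theorem norm_sub_eq_norm_one_sub_conj_mul (a : ℂ) {z : ℂ} (hz : ‖z‖ = 1) :
    ‖z - a‖ = ‖1 - (starRingEnd ℂ) a * z‖ := by
  have h : 1 - (starRingEnd ℂ) a * z = z * (starRingEnd ℂ) (z - a) := by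
    rw [map_sub, mul_sub, Complex.mul_conj, Complex.normSq_eq_norm_sq, hz]
    push_cast; ring
  rw [h, norm_mul, hz, one_mul, RCLike.norm_conj]

/-- For |a| < 1, z - a is the Blaschke factor (z - a)/(1 - āz), unimodular on the circle, times the
zero-free 1 - āz. The latter is split into two equal square roots and the Blaschke factor goes to
one side. For |a| ≥ 1, z - a = -a(1 - z/a) needs only the square root. -/
theorem hasBalancedFactorization_X_sub_C (a : ℂ) :
    HasBalancedFactorization (circlePoly (Polynomial.X - Polynomial.C a)) := by
  rcases lt_or_ge ‖a‖ 1 with ha | ha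
  · have ha' : ‖(starRingEnd ℂ) a‖ < 1 := by rwa [RCLike.norm_conj]
    let b : Metric.closedBall (0 : ℂ) 1 := ⟨(starRingEnd ℂ) a, mem_closedBall_zero_iff.mpr ha'.le⟩
    have hne (θ : UnitAddCircle) : 1 - (starRingEnd ℂ) a * fourier 1 θ ≠ 0 := by
      intro h
      have := congrArg norm (sub_eq_zero.mp h)
      rw [norm_mul, norm_fourier_one, norm_one] at this
      linarith
    let I : C(UnitAddCircle, ℂ) := ⟨fun θ => (1 - (starRingEnd ℂ) a * fourier 1 θ)⁻¹,
      Continuous.inv₀ (by fun_prop) hne⟩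
    have hI : I ∈ diskAlgebra := by
      obtain ⟨R, hbR, hR⟩ := exists_between (show ‖(starRingEnd ℂ) a‖₊ < 1 from ha')
      refine mem_diskAlgebra_of_differentiableOn (h := fun w => (1 - w)⁻¹) (R := R)
        ?_ hbR _ fun θ => rfl
      intro w hw
      exact ((differentiableAt_id.const_sub 1).inv
        (Complex.slitPlane_ne_zero (one_sub_mem_slitPlane hR hw))).differentiableWithinAt
    refine ⟨circlePoly (Polynomial.X - Polynomial.C a) * I * sqrtOneSub b,
      mul_mem (mul_mem (circlePoly_mem_diskAlgebra _) hI) (sqrtOneSub_mem_diskAlgebra b),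
      sqrtOneSub b, sqrtOneSub_mem_diskAlgebra b, ?_, fun θ => ?_⟩
    · ext θ
      simp only [ContinuousMap.mul_apply]
      rw [mul_assoc, sqrtOneSub_mul_self, mul_assoc]
      change _ * ((1 - (starRingEnd ℂ) a * fourier 1 θ)⁻¹ *
        (1 - (starRingEnd ℂ) a * fourier 1 θ)) = _
      rw [inv_mul_cancel₀ (hne θ), mul_one]
    · simp only [ContinuousMap.mul_apply, norm_mul]
      have h1 : ‖circlePoly (Polynomial.X - Polynomial.C a) θ‖ * ‖I θ‖ = 1 := by
        change _ * ‖(1 - (starRingEnd ℂ) a * fourier 1 θ)⁻¹‖ = 1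
        rw [circlePoly_apply, norm_inv, Polynomial.eval_sub, Polynomial.eval_X, Polynomial.eval_C,
          norm_sub_eq_norm_one_sub_conj_mul a (norm_fourier_one θ),
          mul_inv_cancel₀ (norm_ne_zero_iff.mpr (hne θ))]
      rw [h1, one_mul]
  · have ha0 : a ≠ 0 := by rintro rfl; norm_num at ha
    let b : Metric.closedBall (0 : ℂ) 1 :=
      ⟨a⁻¹, mem_closedBall_zero_iff.mpr (by rw [norm_inv]; exact inv_le_one_of_one_le₀ ha)⟩
    have h2 : HasBalancedFactorization (sqrtOneSub b * sqrtOneSub b) :=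
      ⟨_, sqrtOneSub_mem_diskAlgebra b, _, sqrtOneSub_mem_diskAlgebra b, rfl, fun θ => rfl⟩
    convert (hasBalancedFactorization_C (-a)).mul h2
    ext θ
    simp only [ContinuousMap.mul_apply]
    rw [sqrtOneSub_mul_self, circlePoly_apply, circlePoly_apply]
    simp only [Polynomial.eval_sub, Polynomial.eval_X, Polynomial.eval_C, b]
    field_simp
    ring

theorem hasBalancedFactorization_circlePoly (P : Polynomial ℂ) :
    HasBalancedFactorization (circlePoly P) := by
  rw [(IsAlgClosed.splits P).eq_prod_roots, map_mul]
  refine (hasBalancedFactorization_C _).mul ?_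
  induction P.roots using Multiset.induction with
  | empty => simpa using hasBalancedFactorization_C 1
  | cons a s ih =>
    rw [Multiset.map_cons, Multiset.prod_cons, map_mul]
    exact (hasBalancedFactorization_X_sub_C a).mul ih

/-! ### Nehari's theorem on the circle -/

/-- A polynomial on the circle, in `L²`. -/
def circlePolyL2 : Polynomial ℂ →ₗ[ℂ] Lp ℂ 2 (AddCircle.haarAddCircle : Measure UnitAddCircle) :=
  (ContinuousMap.toLp 2 AddCircle.haarAddCircle ℂ).toLinearMap ∘ₗ circlePoly.toLinearMap

theorem norm_toLp_two_sq {X : Type*} [TopologicalSpace X] [CompactSpace X] [MeasurableSpace X]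
    [BorelSpace X] [SecondCountableTopologyEither X ℂ] (μ : Measure X) [IsFiniteMeasure μ]
    (f : C(X, ℂ)) : ‖ContinuousMap.toLp 2 μ ℂ f‖ ^ 2 = ∫ x, ‖f x‖ ^ 2 ∂μ := by
  have h := ContinuousMap.inner_toLp (𝕜 := ℂ) μ f f
  rw [inner_self_eq_norm_sq_to_K] at h
  have h2 : ∫ x, f x * (starRingEnd ℂ) (f x) ∂μ = ((∫ x, ‖f x‖ ^ 2 ∂μ : ℝ) : ℂ) := by
    rw [← integral_complex_ofReal]
    refine integral_congr_ae (Filter.Eventually.of_forall fun x => ?_)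
    simp [Complex.mul_conj, Complex.normSq_eq_norm_sq]
  exact Complex.ofReal_injective ((Complex.ofReal_pow _ 2).trans (h.trans h2))

theorem norm_circlePolyL2_one : ‖circlePolyL2 1‖ = 1 := by
  have h1 : circlePolyL2 1 = ContinuousMap.toLp 2 AddCircle.haarAddCircle ℂ 1 :=
    congrArg (ContinuousMap.toLp 2 AddCircle.haarAddCircle ℂ) (map_one circlePoly)
  have h2 := norm_toLp_two_sq AddCircle.haarAddCircle (1 : C(UnitAddCircle, ℂ))
  simp only [ContinuousMap.one_apply, norm_one, one_pow, integral_const, probReal_univ,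
    smul_eq_mul, mul_one] at h2
  rw [h1]
  exact (pow_eq_one_iff_of_nonneg (norm_nonneg _) two_ne_zero).mp h2

theorem le_on_closure_prod {E : Type*} [TopologicalSpace E] {S : Set E} {u v : E × E → ℝ}
    (hu : Continuous u) (hv : Continuous v) (h : ∀ a ∈ S, ∀ b ∈ S, u (a, b) ≤ v (a, b))
    {a b : E} (ha : a ∈ closure S) (hb : b ∈ closure S) : u (a, b) ≤ v (a, b) := by
  have hmem : (a, b) ∈ closure (S ×ˢ S) := by
    rw [closure_prod_eq]
    exact ⟨ha, hb⟩
  have hsub : closure (S ×ˢ S) ⊆ {p | u p ≤ v p} :=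
    closure_minimal (fun p hp => h p.1 hp.1 p.2 hp.2) (isClosed_le hu hv)
  exact hsub hmem

/-- A functional on polynomials whose Hankel form on `H² × H²` of the circle is bounded by `c`
is bounded by `c` in the `L¹` norm. -/
theorem norm_le_integral_of_hankel_le (l : Polynomial ℂ →ₗ[ℂ] ℂ) (c : ℝ) (hc : 0 ≤ c)
    (h : ∀ F G, ‖l (F * G)‖ ≤ c * (‖circlePolyL2 F‖ * ‖circlePolyL2 G‖)) (P : Polynomial ℂ) :
    ‖l P‖ ≤ c * ∫ θ, ‖circlePoly P θ‖ ∂AddCircle.haarAddCircle := by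
  -- Taking G = 1 shows that l is L²-bounded; extending it to L² gives a functional continuous on
  -- C(𝕋), which can be evaluated on the non-polynomial factors of P.
  obtain ⟨g, hg, hgp⟩ := exists_dual_comp_eq_of_le_seminorm circlePolyL2 l
    (c.toNNReal • normSeminorm ℂ _) (fun F => by
      have := h F 1
      rw [mul_one, norm_circlePolyL2_one, mul_one] at this
      simpa [NNReal.smul_def, hc] using this)
  let Λ : C(UnitAddCircle, ℂ) →L[ℂ] ℂ :=
    (g.mkContinuous c fun f => by simpa [NNReal.smul_def, hc] using hgp f).comp
      (ContinuousMap.toLp 2 AddCircle.haarAddCircle ℂ)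
  let N : C(UnitAddCircle, ℂ) → ℝ := fun F => ‖ContinuousMap.toLp 2 AddCircle.haarAddCircle ℂ F‖
  have hN : Continuous N := (ContinuousLinearMap.continuous _).norm
  have hΛ (F) : Λ (circlePoly F) = l F := hg F
  have hle (F) (hF : F ∈ diskAlgebra) (G) (hG : G ∈ diskAlgebra) :
      ‖Λ (F * G)‖ ≤ c * (N F * N G) := by
    -- Both sides are continuous in the uniform norm, so the Hankel bound passes from polynomials to
    -- the disk algebra.
    refine le_on_closure_prod (S := Set.range circlePoly)
      (u := fun p => ‖Λ (p.1 * p.2)‖) (v := fun p => c * (N p.1 * N p.2)) (by fun_prop)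
      (by fun_prop) ?_ hF hG
    rintro _ ⟨F, rfl⟩ _ ⟨G, rfl⟩
    simp only [← map_mul, hΛ]
    exact h F G
  obtain ⟨F, hF, G, hG, hFG, habs⟩ := hasBalancedFactorization_circlePoly P
  have hsq : ∫ θ, ‖F θ‖ ^ 2 ∂AddCircle.haarAddCircle =
      ∫ θ, ‖circlePoly P θ‖ ∂AddCircle.haarAddCircle := by
    refine integral_congr_ae (Filter.Eventually.of_forall fun θ => ?_)
    simp only [← hFG, ContinuousMap.mul_apply, norm_mul, ← habs]
    ring
  have hNN : N F = N G := by
    have h1 := norm_toLp_two_sq AddCircle.haarAddCircle F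
    have h2 := norm_toLp_two_sq AddCircle.haarAddCircle G
    simp only [← habs] at h2
    exact (pow_left_inj₀ (norm_nonneg _) (norm_nonneg _) two_ne_zero).mp (h1.trans h2.symm)
  have := hle F hF G hG
  rw [hFG, hΛ, ← hNN, ← sq, norm_toLp_two_sq, hsq] at this
  exact this

/-- **Nehari's theorem** with its sharp constant. -/
theorem nehari (l : Polynomial ℂ →ₗ[ℂ] ℂ) (c : ℝ) (hc : 0 ≤ c)
    (h : ∀ F G, ‖l (F * G)‖ ≤ c * (‖circlePolyL2 F‖ * ‖circlePolyL2 G‖)) :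
    ∃ ψ : UnitAddCircle → ℂ, StronglyMeasurable ψ ∧ (∀ θ, ‖ψ θ‖ ≤ c) ∧
      ∀ P, l P = ∫ θ, circlePoly P θ * (starRingEnd ℂ) (ψ θ) ∂AddCircle.haarAddCircle := by
  have hcoe (P : Polynomial ℂ) :
      circlePolyL2 P =ᵐ[AddCircle.haarAddCircle] circlePoly P :=
    ContinuousMap.coeFn_toLp (𝕜 := ℂ) _ (circlePoly P)
  obtain ⟨ψ, hm, hb, hψ⟩ := exists_bounded_symbol circlePolyL2 l c hc fun P => by
    refine (norm_le_integral_of_hankel_le l c hc h P).trans_eq ?_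
    congr 1
    refine integral_congr_ae ?_
    filter_upwards [hcoe P] with θ hθ
    rw [hθ]
  refine ⟨ψ, hm, hb, fun P => ?_⟩
  rw [hψ]
  refine integral_congr_ae ?_
  filter_upwards [hcoe P] with θ hθ
  rw [hθ]

/-! ### Norm of a one-variable Hankel form -/

/-- The norm on `H² × H²` of the circle of the Hankel form of a functional on polynomials. -/
def hankelNorm (l : Polynomial ℂ →ₗ[ℂ] ℂ) : ℝ :=
  sSup {r | ∃ F G, ‖circlePolyL2 F‖ ≤ 1 ∧ ‖circlePolyL2 G‖ ≤ 1 ∧ r = ‖l (F * G)‖}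

section HankelNorm

variable {l : Polynomial ℂ →ₗ[ℂ] ℂ} {C : ℝ}

theorem bddAbove_hankel (hC : 0 ≤ C)
    (h : ∀ F G, ‖l (F * G)‖ ≤ C * (‖circlePolyL2 F‖ * ‖circlePolyL2 G‖)) :
    BddAbove {r | ∃ F G, ‖circlePolyL2 F‖ ≤ 1 ∧ ‖circlePolyL2 G‖ ≤ 1 ∧ r = ‖l (F * G)‖} := by
  refine ⟨C, ?_⟩
  rintro _ ⟨F, G, hF, hG, rfl⟩
  exact (h F G).trans (mul_le_of_le_one_right hC (mul_le_one₀ hF (norm_nonneg _) hG))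

theorem norm_le_hankelNorm (hC : 0 ≤ C)
    (h : ∀ F G, ‖l (F * G)‖ ≤ C * (‖circlePolyL2 F‖ * ‖circlePolyL2 G‖)) (F G : Polynomial ℂ) :
    ‖l (F * G)‖ ≤ hankelNorm l * (‖circlePolyL2 F‖ * ‖circlePolyL2 G‖) := by
  by_cases h0 : ‖circlePolyL2 F‖ * ‖circlePolyL2 G‖ = 0
  · have := h F G
    rwa [h0, mul_zero] at this ⊢
  obtain ⟨hF, hG⟩ := mul_ne_zero_iff.mp h0
  set a := ‖circlePolyL2 F‖ with ha
  set b := ‖circlePolyL2 G‖ with hb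
  have hn {P : Polynomial ℂ} {r : ℝ} (hr : r = ‖circlePolyL2 P‖) (hr0 : r ≠ 0) :
      ‖circlePolyL2 ((r⁻¹ : ℂ) • P)‖ ≤ 1 := by
    rw [map_smul, norm_smul, norm_inv, Complex.norm_real, hr, norm_norm,
      inv_mul_cancel₀ (by rwa [← hr])]
  have key := le_csSup (bddAbove_hankel hC h)
    ⟨(a⁻¹ : ℂ) • F, (b⁻¹ : ℂ) • G, hn ha hF, hn hb hG, rfl⟩
  rw [smul_mul_smul_comm, map_smul, norm_smul, norm_mul, norm_inv, norm_inv, Complex.norm_real,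
    Complex.norm_real, ha, hb, norm_norm, norm_norm, ← ha, ← hb] at key
  have hab : 0 < a * b := lt_of_le_of_ne (by positivity) (Ne.symm h0)
  rw [← mul_inv, inv_mul_le_iff₀ hab] at key
  exact key.trans_eq (mul_comm _ _)

theorem exists_lt_of_lt_hankelNorm {x : ℝ} (hx : x < hankelNorm l) :
    ∃ F G, ‖circlePolyL2 F‖ ≤ 1 ∧ ‖circlePolyL2 G‖ ≤ 1 ∧ x < ‖l (F * G)‖ := by
  have hne : {r | ∃ F G, ‖circlePolyL2 F‖ ≤ 1 ∧ ‖circlePolyL2 G‖ ≤ 1 ∧ r = ‖l (F * G)‖}.Nonempty :=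
    ⟨_, 0, 0, by simp, by simp, rfl⟩
  obtain ⟨_, ⟨F, G, hF, hG, rfl⟩, hlt⟩ := exists_lt_of_lt_csSup hne hx
  exact ⟨F, G, hF, hG, hlt⟩

end HankelNorm

/-! ### Products over the variables -/

/-- The polynomial `F(z_j)`. -/
def polyInVar (j : ℕ) : Polynomial ℂ →ₐ[ℂ] MvPolynomial ℕ ℂ :=
  Polynomial.aeval (MvPolynomial.X j)

theorem torusPoly_polyInVar (j : ℕ) (F : Polynomial ℂ) (θ : UnitAddTorus ℕ) :
    torusPoly (polyInVar j F) θ = circlePoly F (θ j) := by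
  have h1 : torusPoly (polyInVar j F) = Polynomial.aeval (torusCoord j) F := by
    rw [polyInVar, ← Polynomial.aeval_algHom_apply, torusPoly, MvPolynomial.aeval_X]
  have h2 := Polynomial.aeval_algHom_apply (ContinuousMap.evalAlgHom ℂ ℂ θ) (torusCoord j) F
  rw [Polynomial.coe_aeval_eq_eval] at h2
  rw [h1, circlePoly_apply]
  refine h2.symm.trans ?_
  congr 1
  change (AddCircle.toCircle (θ j) : ℂ) = fourier 1 (θ j)
  rw [fourier_apply, one_smul]

theorem monomial_eq_prod_polyInVar {k : ℕ →₀ ℕ} {s : Finset ℕ} (hs : k.support ⊆ s) :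
    MvPolynomial.monomial k (1 : ℂ) = ∏ j ∈ s, polyInVar j (Polynomial.X ^ k j) := by
  rw [MvPolynomial.monomial_eq, map_one, one_mul,
    Finsupp.prod_of_support_subset k hs _ (by simp)]
  simp [polyInVar]

theorem integral_prod_torus (s : Finset ℕ) (f : ℕ → UnitAddCircle → ℂ)
    (hf : ∀ j, StronglyMeasurable (f j)) :
    ∫ θ, ∏ j ∈ s, f j (θ j) ∂torusMeasure = ∏ j ∈ s, ∫ x, f j x ∂AddCircle.haarAddCircle := by
  have h1 (θ : UnitAddTorus ℕ) : ∏ j ∈ s, f j (θ j) =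
      (fun y : s → UnitAddCircle => ∏ i : s, f i (y i)) (s.restrict θ) := by
    simp only [Finset.restrict]
    rw [Finset.prod_coe_sort s (fun i => f i (θ i))]
  simp only [h1]
  rw [torusMeasure]
  refine (integral_restrict_infinitePi (s := s)
    (μ := fun _ : ℕ => (AddCircle.haarAddCircle : Measure UnitAddCircle))
    (f := fun y : s → UnitAddCircle => ∏ i : s, f i (y i)) ?_).trans ?_
  · exact (Finset.stronglyMeasurable_fun_prod (M := ℂ) Finset.univ
      (f := fun (i : s) (y : s → UnitAddCircle) => f i (y i)) fun i _ =>
      (hf i).comp_measurable (measurable_pi_apply i)).aestronglyMeasurable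
  · rw [integral_fintype_prod_eq_prod]
    exact Finset.prod_coe_sort s (fun i => ∫ x, f i x ∂AddCircle.haarAddCircle)

theorem norm_torusPolyL2_prod (s : Finset ℕ) (F : ℕ → Polynomial ℂ) :
    ‖torusPolyL2 (∏ j ∈ s, polyInVar j (F j))‖ = ∏ j ∈ s, ‖circlePolyL2 (F j)‖ := by
  refine (pow_left_inj₀ (norm_nonneg _) (Finset.prod_nonneg fun _ _ => norm_nonneg _)
    two_ne_zero).mp ?_
  have h1 := norm_toLp_two_sq torusMeasure (torusPoly (∏ j ∈ s, polyInVar j (F j)))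
  have h2 (j : ℕ) := norm_toLp_two_sq AddCircle.haarAddCircle (circlePoly (F j))
  refine h1.trans ?_
  rw [← Finset.prod_pow]
  have h3 : ∏ j ∈ s, ‖circlePolyL2 (F j)‖ ^ 2 =
      ∏ j ∈ s, ∫ x, ‖circlePoly (F j) x‖ ^ 2 ∂AddCircle.haarAddCircle :=
    Finset.prod_congr rfl fun j _ => h2 j
  rw [h3]
  apply Complex.ofReal_injective
  push_cast
  simp only [← integral_complex_ofReal]
  rw [← integral_prod_torus s (fun j x => ((‖circlePoly (F j) x‖ ^ 2 : ℝ) : ℂ)) fun j =>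
    Continuous.stronglyMeasurable (by fun_prop)]
  refine integral_congr_ae (Filter.Eventually.of_forall fun θ => ?_)
  simp only [map_prod, ContinuousMap.prod_apply, torusPoly_polyInVar, norm_prod]
  push_cast
  rw [Finset.prod_pow]

section Multiplicative

variable {l : MvPolynomial ℕ ℂ →ₗ[ℂ] ℂ}

/-- The extra monomial k drives the induction: by linearity the factor in a new variable is a
monomial, which is absorbed into k. -/
theorem map_monomial_mul_prod_polyInVar
    (hmul : ∀ k m : ℕ →₀ ℕ, Disjoint k.support m.support →
      l (MvPolynomial.monomial (k + m) 1) =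
        l (MvPolynomial.monomial k 1) * l (MvPolynomial.monomial m 1))
    (F : ℕ → Polynomial ℂ) (s : Finset ℕ) (k : ℕ →₀ ℕ) (hk : Disjoint k.support s) :
    l (MvPolynomial.monomial k 1 * ∏ j ∈ s, polyInVar j (F j)) =
      l (MvPolynomial.monomial k 1) * ∏ j ∈ s, l (polyInVar j (F j)) := by
  classical
  induction s using Finset.induction_on generalizing k with
  | empty => simp
  | insert i s hi ih =>
    rw [Finset.prod_insert hi, Finset.prod_insert hi]
    rw [Finset.disjoint_insert_right] at hk
    induction F i using Polynomial.induction_on' with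
    | add p q hp hq => rw [map_add, map_add, add_mul, mul_add, map_add, hp, hq]; ring
    | monomial n a =>
      have h2 : polyInVar i (Polynomial.monomial n a) =
          a • MvPolynomial.monomial (Finsupp.single i n) 1 := by
        rw [polyInVar, Polynomial.aeval_monomial, MvPolynomial.X_pow_eq_monomial,
          Algebra.smul_def]
      have hd : Disjoint k.support (Finsupp.single i n).support :=
        Finset.disjoint_of_subset_right Finsupp.support_single_subset
          (Finset.disjoint_singleton_right.mpr hk.1)
      have hd' : Disjoint (k + Finsupp.single i n).support s := by
        refine Finset.disjoint_of_subset_left Finsupp.support_add ?_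
        rw [Finset.disjoint_union_left]
        exact ⟨hk.2, Finset.disjoint_of_subset_left Finsupp.support_single_subset
          (Finset.disjoint_singleton_left.mpr hi)⟩
      rw [h2, smul_mul_assoc, mul_smul_comm, map_smul, map_smul, ← mul_assoc,
        MvPolynomial.monomial_mul, one_mul, ih _ hd', hmul _ _ hd, smul_eq_mul, smul_eq_mul]
      ring

theorem map_prod_polyInVar (h1 : l 1 = 1)
    (hmul : ∀ k m : ℕ →₀ ℕ, Disjoint k.support m.support →
      l (MvPolynomial.monomial (k + m) 1) =
        l (MvPolynomial.monomial k 1) * l (MvPolynomial.monomial m 1))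
    (F : ℕ → Polynomial ℂ) (s : Finset ℕ) :
    l (∏ j ∈ s, polyInVar j (F j)) = ∏ j ∈ s, l (polyInVar j (F j)) := by
  have := map_monomial_mul_prod_polyInVar hmul F s 0 (by simp)
  have h0 : MvPolynomial.monomial (0 : ℕ →₀ ℕ) (1 : ℂ) = 1 := rfl
  rwa [h0, one_mul, h1, one_mul] at this

theorem prod_hankelNorm_le (h1 : l 1 = 1)
    (hmul : ∀ k m : ℕ →₀ ℕ, Disjoint k.support m.support →
      l (MvPolynomial.monomial (k + m) 1) =
        l (MvPolynomial.monomial k 1) * l (MvPolynomial.monomial m 1))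
    {C : ℝ} (hC : 0 ≤ C)
    (h : ∀ F G, ‖l (F * G)‖ ≤ C * (‖torusPolyL2 F‖ * ‖torusPolyL2 G‖))
    (hpos : ∀ j, 0 < hankelNorm (l ∘ₗ (polyInVar j).toLinearMap)) (s : Finset ℕ) :
    ∏ j ∈ s, hankelNorm (l ∘ₗ (polyInVar j).toLinearMap) ≤ C := by
  set c := fun j => hankelNorm (l ∘ₗ (polyInVar j).toLinearMap)
  -- The suprema need not be attained: choose pairs exceeding t·c_j in each variable, multiply them,
  -- then let t → 1.
  have ht (t : ℝ) (ht0 : 0 ≤ t) (ht1 : t < 1) : ∏ j ∈ s, (t * c j) ≤ C := by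
    choose F G hF hG hlt using fun j => exists_lt_of_lt_hankelNorm
      (mul_lt_of_lt_one_left (hpos j) ht1)
    calc ∏ j ∈ s, (t * c j) ≤ ∏ j ∈ s, ‖l (polyInVar j (F j * G j))‖ :=
          Finset.prod_le_prod (fun j _ => mul_nonneg ht0 (hpos j).le) fun j _ => (hlt j).le
      _ = ‖l ((∏ j ∈ s, polyInVar j (F j)) * ∏ j ∈ s, polyInVar j (G j))‖ := by
          rw [← Finset.prod_mul_distrib]
          simp only [← map_mul]
          rw [map_prod_polyInVar h1 hmul (fun j => F j * G j), norm_prod]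
      _ ≤ C := by
          refine (h _ _).trans (mul_le_of_le_one_right hC (mul_le_one₀ ?_ (norm_nonneg _) ?_)) <;>
          · rw [norm_torusPolyL2_prod]
            exact Finset.prod_le_one (fun _ _ => norm_nonneg _) fun j _ => by
              first | exact hF j | exact hG j
  have hcont : ContinuousWithinAt (fun t : ℝ => ∏ j ∈ s, (t * c j)) (Set.Iio 1) 1 :=
    Continuous.continuousWithinAt (by fun_prop)
  have hlim := hcont.tendsto
  simp only [one_mul] at hlim
  refine le_of_tendsto hlim ?_
  filter_upwards [Ioo_mem_nhdsLT (show (0 : ℝ) < 1 by norm_num)] with t ht'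
  exact ht t ht'.1.le ht'.2

/-- A functional that is multiplicative across the variables and whose Hankel form on
`H²(𝕋^∞) × H²(𝕋^∞)` is bounded is bounded in the `L¹` norm. -/
theorem norm_le_integral_torus (h1 : l 1 = 1)
    (hmul : ∀ k m : ℕ →₀ ℕ, Disjoint k.support m.support →
      l (MvPolynomial.monomial (k + m) 1) =
        l (MvPolynomial.monomial k 1) * l (MvPolynomial.monomial m 1))
    {C : ℝ} (hC : 0 ≤ C)
    (h : ∀ F G, ‖l (F * G)‖ ≤ C * (‖torusPolyL2 F‖ * ‖torusPolyL2 G‖))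
    (P : MvPolynomial ℕ ℂ) :
    ‖l P‖ ≤ C * ∫ θ, ‖torusPoly P θ‖ ∂torusMeasure := by
  classical
  set L := fun j => l ∘ₗ (polyInVar j).toLinearMap
  have hL (j : ℕ) (F G : Polynomial ℂ) :
      ‖L j (F * G)‖ ≤ C * (‖circlePolyL2 F‖ * ‖circlePolyL2 G‖) := by
    have hn (F : Polynomial ℂ) : ‖torusPolyL2 (polyInVar j F)‖ = ‖circlePolyL2 F‖ := by
      simpa using norm_torusPolyL2_prod {j} fun _ => F
    have := h (polyInVar j F) (polyInVar j G)
    rwa [hn, hn, ← map_mul] at this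
  -- Since l(1) = 1, the pair (1, 1) shows that this norm is at least 1.
  have hpos (j : ℕ) : 0 < hankelNorm (L j) := by
    have h2 := norm_le_hankelNorm hC (hL j) 1 1
    have h3 : L j (1 * 1) = 1 := by
      change l (polyInVar j (1 * 1)) = 1
      rw [mul_one, map_one, h1]
    rw [h3, norm_one, norm_circlePolyL2_one, mul_one, mul_one] at h2
    linarith
  choose ψ hψm hψb hψ using fun j => nehari (L j) (hankelNorm (L j)) (hpos j).le
    (norm_le_hankelNorm hC (hL j))
  -- Only the variables occurring in P enter, so Ψ depends on P but its bound C does not.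
  set s : Finset ℕ := P.support.biUnion Finsupp.support
  set Ψ : UnitAddTorus ℕ → ℂ := fun θ => ∏ j ∈ s, (starRingEnd ℂ) (ψ j (θ j))
  have hΨm : StronglyMeasurable Ψ := Finset.stronglyMeasurable_fun_prod _ fun j _ =>
    RCLike.continuous_conj.comp_stronglyMeasurable
      ((hψm j).comp_measurable (measurable_pi_apply j))
  have hΨb (θ : UnitAddTorus ℕ) : ‖Ψ θ‖ ≤ C := by
    rw [norm_prod]
    refine le_trans (Finset.prod_le_prod (fun _ _ => norm_nonneg _) fun j _ => ?_)
      (prod_hankelNorm_le h1 hmul hC h hpos s)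
    rw [RCLike.norm_conj]
    exact hψb j (θ j)
  have hint (Q : MvPolynomial ℕ ℂ) : Integrable (fun θ => torusPoly Q θ) torusMeasure :=
    (torusPoly Q).continuous.integrable_of_hasCompactSupport
      (HasCompactSupport.of_compactSpace _)
  have hint2 (Q : MvPolynomial ℕ ℂ) : Integrable (fun θ => torusPoly Q θ * Ψ θ) torusMeasure :=
    (hint Q).mul_bdd (c := C) hΨm.aestronglyMeasurable (Filter.Eventually.of_forall hΨb)
  have hmono (k : ℕ →₀ ℕ) (hk : k ∈ P.support) : l (MvPolynomial.monomial k 1) =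
      ∫ θ, torusPoly (MvPolynomial.monomial k 1) θ * Ψ θ ∂torusMeasure := by
    have hks : k.support ⊆ s := Finset.subset_biUnion_of_mem Finsupp.support hk
    rw [monomial_eq_prod_polyInVar hks, map_prod_polyInVar h1 hmul]
    have h4 (j : ℕ) := hψ j (Polynomial.X ^ k j)
    have h5 : ∏ j ∈ s, l (polyInVar j (Polynomial.X ^ k j)) = ∏ j ∈ s, ∫ θ,
        circlePoly (Polynomial.X ^ k j) θ * (starRingEnd ℂ) (ψ j θ) ∂AddCircle.haarAddCircle :=
      Finset.prod_congr rfl fun j _ => h4 j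
    rw [h5, ← integral_prod_torus s (fun j θ => circlePoly (Polynomial.X ^ k j) θ *
      (starRingEnd ℂ) (ψ j θ)) fun j => (ContinuousMap.continuous _).stronglyMeasurable.mul
        (RCLike.continuous_conj.comp_stronglyMeasurable (hψm j))]
    simp only [map_prod, ContinuousMap.prod_apply, torusPoly_polyInVar,
      Finset.prod_mul_distrib, Ψ]
  have hP : P = ∑ k ∈ P.support, P.coeff k • MvPolynomial.monomial k 1 := by
    conv_lhs => rw [P.as_sum]
    simp [MvPolynomial.smul_monomial]
  have hlP : l P = ∫ θ, torusPoly P θ * Ψ θ ∂torusMeasure := by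
    have h6 (θ : UnitAddTorus ℕ) : torusPoly P θ * Ψ θ = ∑ k ∈ P.support,
        P.coeff k * (torusPoly (MvPolynomial.monomial k 1) θ * Ψ θ) := by
      conv_lhs => rw [hP]
      simp only [map_sum, map_smul, ContinuousMap.sum_apply, ContinuousMap.smul_apply,
        Finset.sum_mul, smul_eq_mul, mul_assoc]
    simp only [h6]
    rw [integral_finsetSum _ fun k _ => (hint2 _).const_mul _]
    conv_lhs => rw [hP]
    rw [map_sum]
    refine Finset.sum_congr rfl fun k hk => ?_
    rw [map_smul, hmono k hk, integral_const_mul, smul_eq_mul]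
  rw [hlP, ← integral_const_mul]
  refine (norm_integral_le_integral_norm _).trans
    (integral_mono (hint2 P).norm ((hint P).norm.const_mul C) fun θ => ?_)
  rw [norm_mul, mul_comm]
  exact mul_le_mul_of_nonneg_right (hΨb θ) (norm_nonneg _)

end Multiplicative

/-! ### Integers, exponents and the coefficients of the Bohr lift -/

/-- The integer `∏ p_j ^ k_j` with prime exponents `k`. -/
def natOfExponents (k : ℕ →₀ ℕ) : ℕ :=
  k.prod fun j e => Nat.nth Nat.Prime j ^ e

theorem prime_nth (j : ℕ) : (Nat.nth Nat.Prime j).Prime :=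
  Nat.nth_mem_of_infinite Nat.infinite_setOfPred_prime j

theorem nth_prime_injective : Function.Injective (Nat.nth Nat.Prime) :=
  Nat.nth_injective Nat.infinite_setOfPred_prime

theorem natOfExponents_ne_zero (k : ℕ →₀ ℕ) : natOfExponents k ≠ 0 :=
  Finset.prod_ne_zero_iff.mpr fun j _ => pow_ne_zero _ (prime_nth j).ne_zero

theorem natOfExponents_add (k m : ℕ →₀ ℕ) :
    natOfExponents (k + m) = natOfExponents k * natOfExponents m :=
  Finsupp.prod_add_index' (by simp) fun _ _ _ => pow_add _ _ _

theorem primeExponents_natOfExponents (k : ℕ →₀ ℕ) : primeExponents (natOfExponents k) = k := by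
  have h1 : natOfExponents k = (k.mapDomain (Nat.nth Nat.Prime)).prod (· ^ ·) :=
    (Finsupp.prod_mapDomain_index_inj nth_prime_injective).symm
  rw [primeExponents, h1]
  have h2 : ((k.mapDomain (Nat.nth Nat.Prime)).prod (· ^ ·)).factorization =
      k.mapDomain (Nat.nth Nat.Prime) := by
    refine Nat.prod_pow_factorization_eq_self fun p hp => ?_
    obtain ⟨j, _, rfl⟩ := Finset.mem_image.mp (Finsupp.mapDomain_support hp)
    exact prime_nth j
  ext j
  rw [Finsupp.comapDomain_apply, h2, Finsupp.mapDomain_apply nth_prime_injective]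

theorem coprime_natOfExponents {k m : ℕ →₀ ℕ} (h : Disjoint k.support m.support) :
    (natOfExponents k).Coprime (natOfExponents m) := by
  refine Nat.Coprime.prod_left fun i hi => Nat.Coprime.prod_right fun j hj => ?_
  refine Nat.Coprime.pow _ _ ((Nat.coprime_primes (prime_nth i) (prime_nth j)).mpr ?_)
  exact nth_prime_injective.ne (Finset.disjoint_iff_ne.mp h i hi j hj)

theorem inner_bohrLift_monomial {α : ArithmeticFunction ℂ} (hα : MemDirichletH2 α) (k : ℕ →₀ ℕ) :
    inner ℂ (bohrLift α) (torusPolyL2 (MvPolynomial.monomial k 1)) =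
      (starRingEnd ℂ) (α (natOfExponents k)) := by
  rw [← inner_conj_symm]
  congr 1
  have h1 := (hasSum_bohrLift hα).mapL
    (innerSL ℂ (torusPolyL2 (MvPolynomial.monomial k 1)))
  refine h1.unique ?_
  have ho := orthonormal_iff_ite.mp orthonormal_monomials k
  convert hasSum_single (natOfExponents k) ?_ using 1
  · simp only [innerSL_apply_apply, inner_smul_right]
    rw [ho, primeExponents_natOfExponents, if_pos rfl, mul_one]
  · intro n hn
    simp only [innerSL_apply_apply, inner_smul_right]
    rw [ho]
    split_ifs with hk
    -- The index 0 has the same exponents as 1, but its coefficient vanishes.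
    · rcases eq_or_ne n 0 with rfl | hn0
      · simp
      · exact absurd (primeExponents_injOn hn0 (natOfExponents_ne_zero k)
          (hk.symm.trans (primeExponents_natOfExponents k).symm)) hn
    · rw [mul_zero]

/-! ### Pairing with the Bohr lift and conclusion -/

/-- The functional `P ↦ ⟨P, Φ⟩` on polynomials. -/
def pairing (Φ : TorusL2) : MvPolynomial ℕ ℂ →ₗ[ℂ] ℂ :=
  (innerSL ℂ Φ).toLinearMap ∘ₗ torusPolyL2

theorem pairing_apply (Φ : TorusL2) (P : MvPolynomial ℕ ℂ) :
    pairing Φ P = inner ℂ Φ (torusPolyL2 P) := rfl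

theorem bohrLift_mem_hardyH2 {α : ArithmeticFunction ℂ} (hα : MemDirichletH2 α) :
    bohrLift α ∈ hardyH2 :=
  (Submodule.isClosed_topologicalClosure _).mem_of_tendsto (hasSum_bohrLift hα)
    (Filter.Eventually.of_forall fun _ => Submodule.sum_mem _ fun _ _ =>
      Submodule.smul_mem _ _ (Submodule.le_topologicalClosure _ (LinearMap.mem_range_self _ _)))

/-- Equal pairings make Φ - Ψ orthogonal to the polynomials, hence to their closure. -/
theorem eq_rieszProj_of_pairing_eq {Φ Ψ : TorusL2} (hΦ : Φ ∈ hardyH2)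
    (h : ∀ P, pairing Φ P = pairing Ψ P) : Φ = rieszProj Ψ := by
  refine (Submodule.eq_starProjection_of_mem_orthogonal hΦ ?_).symm
  rw [hardyH2, Submodule.orthogonal_closure, Submodule.mem_orthogonal']
  rintro _ ⟨P, rfl⟩
  rw [inner_sub_left]
  exact sub_eq_zero.mpr (h P).symm

theorem ContinuousLinearMap.exists_norm_le_mul {E : Type*} [NormedAddCommGroup E]
    [NormedSpace ℂ E] (B : E →L[ℂ] E →L[ℂ] ℂ) :
    ∃ C : ℝ, 0 ≤ C ∧ ∀ x y, ‖B x y‖ ≤ C * (‖x‖ * ‖y‖) :=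
  ⟨‖B‖, norm_nonneg B, fun x y => (B.le_opNorm₂ x y).trans_eq (mul_assoc _ _ _)⟩

theorem exists_bounded_of_isBoundedHankelForm {α : ArithmeticFunction ℂ} (hφ : MemDirichletH2 α)
    (hα : α.IsMultiplicative) (hB : IsBoundedHankelForm (bohrLift α)) :
    ∃ (Ψ : UnitAddTorus ℕ → ℂ) (hΨ : MemLp Ψ ∞ torusMeasure),
      bohrLift α = rieszProj ((hΨ.mono_exponent le_top : MemLp Ψ 2 torusMeasure).toLp Ψ) := by
  obtain ⟨B, hB⟩ := hB
  obtain ⟨C, hC, hBC⟩ := ContinuousLinearMap.exists_norm_le_mul (E := hardyH2) B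
  have hbound (F G : MvPolynomial ℕ ℂ) : ‖pairing (bohrLift α) (F * G)‖ ≤
      C * (‖torusPolyL2 F‖ * ‖torusPolyL2 G‖) := by
    have h := hBC (hardyPoly F) (hardyPoly G)
    rw [hB] at h
    exact h
  have hmono (k : ℕ →₀ ℕ) : pairing (bohrLift α) (MvPolynomial.monomial k 1) =
      (starRingEnd ℂ) (α (natOfExponents k)) := inner_bohrLift_monomial hφ k
  have hone : pairing (bohrLift α) 1 = 1 := by
    have := hmono 0
    rw [show natOfExponents 0 = 1 from Finsupp.prod_zero_index, hα.map_one,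
      map_one (starRingEnd ℂ)] at this
    exact this
  have hmul (k m : ℕ →₀ ℕ) (hd : Disjoint k.support m.support) :
      pairing (bohrLift α) (MvPolynomial.monomial (k + m) 1) =
        pairing (bohrLift α) (MvPolynomial.monomial k 1) *
          pairing (bohrLift α) (MvPolynomial.monomial m 1) := by
    rw [hmono, hmono, hmono, natOfExponents_add,
      hα.map_mul_of_coprime (coprime_natOfExponents hd), map_mul]
  have hcoe (P : MvPolynomial ℕ ℂ) : torusPolyL2 P =ᵐ[torusMeasure] torusPoly P :=
    ContinuousMap.coeFn_toLp (𝕜 := ℂ) _ (torusPoly P)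
  obtain ⟨Ψ, hm, hb, hΨ⟩ := exists_bounded_symbol torusPolyL2 (pairing (bohrLift α)) C
    hC fun P => by
      refine (norm_le_integral_torus hone hmul hC hbound P).trans_eq ?_
      congr 1
      refine integral_congr_ae ?_
      filter_upwards [hcoe P] with θ hθ
      rw [hθ]
  have hΨ' : MemLp Ψ ∞ torusMeasure :=
    memLp_top_of_bound hm.aestronglyMeasurable C (Filter.Eventually.of_forall hb)
  refine ⟨Ψ, hΨ', eq_rieszProj_of_pairing_eq (bohrLift_mem_hardyH2 hφ) fun P => ?_⟩
  rw [hΨ, pairing_apply, L2.inner_def]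
  refine integral_congr_ae ?_
  filter_upwards [(hΨ'.mono_exponent le_top : MemLp Ψ 2 torusMeasure).coeFn_toLp] with θ hθ
  rw [hθ, RCLike.inner_apply]

theorem isBoundedHankelForm_of_pairing_mul {Φ : TorusL2}
    (h : ∀ F G, pairing Φ (F * G) = pairing Φ F * pairing Φ G) : IsBoundedHankelForm Φ := by
  let e : hardyH2 →L[ℂ] ℂ := (innerSL ℂ Φ).comp hardyH2.subtypeL
  exact ⟨e.smulRight e, fun F G => (h F G).symm⟩

theorem pairing_bohrLift_mul {α : ArithmeticFunction ℂ} (hφ : MemDirichletH2 α)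
    (hα : ∀ m n : ℕ, α (m * n) = α m * α n) (F G : MvPolynomial ℕ ℂ) :
    pairing (bohrLift α) (F * G) = pairing (bohrLift α) F * pairing (bohrLift α) G := by
  have hmono (k : ℕ →₀ ℕ) (a : ℂ) : pairing (bohrLift α) (MvPolynomial.monomial k a) =
      a * (starRingEnd ℂ) (α (natOfExponents k)) := by
    rw [← inner_bohrLift_monomial hφ k, ← pairing_apply, ← smul_eq_mul a, ← map_smul,
      MvPolynomial.smul_monomial, smul_eq_mul, mul_one]
  induction F using MvPolynomial.induction_on' with
  | add p q hp hq => rw [add_mul, map_add, map_add, hp, hq, add_mul]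
  | monomial k a =>
    induction G using MvPolynomial.induction_on' with
    | add p q hp hq => rw [mul_add, map_add, map_add, hp, hq, mul_add]
    | monomial m b =>
      rw [MvPolynomial.monomial_mul, hmono, hmono, hmono, natOfExponents_add, hα, map_mul]
      ring

end

theorem theorem6 (α : ArithmeticFunction ℂ) (hφ : MemDirichletH2 α) (hα : α.IsMultiplicative) :
    (IsBoundedHankelForm (bohrLift α) →
      ∃ (Ψ : UnitAddTorus ℕ → ℂ) (hΨ : MemLp Ψ ∞ torusMeasure),
        bohrLift α = rieszProj ((hΨ.mono_exponent le_top : MemLp Ψ 2 torusMeasure).toLp Ψ)) ∧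
    ((∀ m n : ℕ, α (m * n) = α m * α n) → IsBoundedHankelForm (bohrLift α)) := by
  refine ⟨exists_bounded_of_isBoundedHankelForm hφ hα, fun hmul => ?_⟩
  exact isBoundedHankelForm_of_pairing_mul (pairing_bohrLift_mul hφ hmul)
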